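/- Let $(W,S)$, $S=\{s_1,s_2,s_3,s_4\}$, be a Coxeter system of rank $4$ with Coxeter matrix $(m_{ij})$, i.e. $W=\langle s_1,\dots,s_4 \mid (s_is_j)^{m_{ij}}=1\rangle$ with $m_{ii}=1$ and $m_{ij}=m_{ji}\ge 2$ for $i\ne j$. Assume that all $m_{ij}$ are finite and odd, that $m_{1i}=5k_i$ for $2\le i\le 4$, where the $k_i$ are positive integers not divisible by $3$, and that $m_{ij}=3k_{ij}$ for $2\le i,j\le 4$, $i\neq j$, where the $k_{ij}$ are positive integers. Then $W$ has no finite index reflection subgroup; that is, there is no subgroup $V\subsetneq W$ of finite index that is generated by reflections (elements of $W$ conjugate in $W$ to elements of $S$). -/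

import Mathlib

/-- A Coxeter matrix is odd-angled if every entry is odd or infinite.
Mathlib encodes the value `∞` (no relation between the two generators) by `0`. -/
def CoxeterMatrix.IsOddAngled {B : Type*} (M : CoxeterMatrix B) : Prop :=
  ∀ i j : B, M i j = 0 ∨ Odd (M i j)

/-- A reflection subgroup of a Coxeter system: a proper subgroup generated by some set of
reflections, that is, of conjugates of simple generators. -/
def CoxeterSystem.IsReflectionSubgroup {B : Type*} {M : CoxeterMatrix B} {W : Type*} [Group W]
    (cs : CoxeterSystem M W) (V : Subgroup W) : Prop :=
  V ≠ ⊤ ∧ ∃ T : Set W, (∀ t ∈ T, cs.IsReflection t) ∧ V = Subgroup.closure T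

/-!
View the elements of `W` as chambers. If `V` is generated by reflections and has finite index, the
chambers that no reflection of `V` separates from `1` are finitely many, so one of them, `c`, is
farthest from `1`. No two simple reflections commute, so an element of `W` has at most two right
descents; and the fundamental chambers around a face of codimension two form a sector whose size
divides an odd `m`, so it has at least three chambers when it has more than one, and at least five
when `3` does not divide `m`. Turning around faces through `c` therefore reaches further farthest
chambers, and if `c` had a right descent they would produce an element with three right descents.
So `c = 1`: every simple reflection bounds the fundamental domain, whence `V = W`.
-/

section GeometricRepresentation

open Module Polynomial Real

theorem eval_chebyshevS_two_mul_cos_eq_zero {θ : ℝ} {q : ℕ} (hsin : sin θ ≠ 0)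
    (hθ : q * θ = π) : (Chebyshev.S ℝ (q - 1)).eval (2 * cos θ) = 0 := by
  refine (mul_eq_zero_iff_right hsin).1 ?_
  rw [Chebyshev.S_two_mul_real_cos]
  push_cast
  rw [sub_add_cancel, hθ, sin_pi]

theorem eval_chebyshevS_add_two_mul_cos_eq_zero {θ : ℝ} {q : ℕ} (hsin : sin θ ≠ 0)
    (hθ : (2 * q + 1) * θ = 2 * π) :
    (Chebyshev.S ℝ q).eval (2 * cos θ) + (Chebyshev.S ℝ (q - 1)).eval (2 * cos θ) = 0 := by
  refine (mul_eq_zero_iff_right hsin).1 ?_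
  rw [add_mul, Chebyshev.S_two_mul_real_cos, Chebyshev.S_two_mul_real_cos]
  push_cast
  rw [sub_add_cancel, show (q + 1) * θ = 2 * π - q * θ by linarith, sin_two_pi_sub, neg_add_cancel]

theorem reflection_mul_reflection_pow_eq_one {V : Type*} [AddCommGroup V] [Module ℝ V] {x y : V}
    {f g : Dual ℝ V} (hf : f x = 2) (hg : g y = 2) {m : ℕ} (hm : 3 ≤ m)
    (hfg : f y * g x = 4 * cos (π / m) ^ 2) : (reflection hf * reflection hg) ^ m = 1 := by
  set θ := 2 * (π / m) with hθ
  have hm₀ : (0 : ℝ) < m := by positivity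
  have hmθ : m * θ = 2 * π := by rw [hθ]; field_simp
  have hsin : sin θ ≠ 0 := by
    refine (sin_pos_of_pos_of_lt_pi (by positivity) ?_).ne'
    have : (3 : ℝ) ≤ m := by exact_mod_cast hm
    nlinarith [pi_pos]
  have ht : 2 * cos θ = f y * g x - 2 := by rw [hfg, hθ, cos_two_mul]; ring
  ext z
  rw [reflection_mul_reflection_pow_apply hf hg m z _ ht]
  obtain ⟨q, rfl | rfl⟩ := m.even_or_odd'
  · have hS := eval_chebyshevS_two_mul_cos_eq_zero (q := q) hsin (by push_cast at hmθ; linarith)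
    rw [show ((2 * q : ℕ) - 2 : ℤ) / 2 = q - 1 by lia,
      show ((2 * q : ℕ) - 1 : ℤ) / 2 = q - 1 by lia, hS]
    simp
  · have hS := eval_chebyshevS_add_two_mul_cos_eq_zero (q := q) hsin (by push_cast at hmθ; linarith)
    rw [show ((2 * q + 1 : ℕ) - 2 : ℤ) / 2 = q - 1 by lia,
      show ((2 * q + 1 : ℕ) - 1 : ℤ) / 2 = q by lia,
      show ((2 * q + 1 : ℕ) - 3 : ℤ) / 2 = q - 1 by lia,
      show ((2 * q + 1 : ℕ) : ℤ) / 2 = q by lia, hS]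
    simp

variable {B : Type*} (M : CoxeterMatrix B)

/-- The coroot of the standard geometric representation: twice the pairing with the simple root
`α i` under the bilinear form `⟨α i, α j⟩ = -cos (π / M i j)`. For `M i j = 0`, which encodes `∞`,
the convention `π / 0 = 0` gives the customary value `-1`. -/
noncomputable def simpleCoroot (i : B) : Dual ℝ (B →₀ ℝ) :=
  Finsupp.linearCombination ℝ fun j ↦ -2 * cos (π / M i j)

theorem simpleCoroot_single (i j : B) :
    simpleCoroot M i (Finsupp.single j 1) = -2 * cos (π / M i j) := by
  simp [simpleCoroot]

theorem simpleCoroot_single_self (i : B) : simpleCoroot M i (Finsupp.single i 1) = 2 := by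
  simp [simpleCoroot_single]

theorem simpleCoroot_single_comm (i j : B) :
    simpleCoroot M i (Finsupp.single j 1) = simpleCoroot M j (Finsupp.single i 1) := by
  rw [simpleCoroot_single, simpleCoroot_single, M.symmetric]

theorem simpleCoroot_single_ne_zero {i j : B} (hM : M i j ≠ 2) :
    simpleCoroot M i (Finsupp.single j 1) ≠ 0 := by
  rw [simpleCoroot_single]
  rcases eq_or_ne (M i j) 1 with h1 | h1
  · simp [h1]
  rcases Nat.eq_zero_or_pos (M i j) with h0 | h0
  · simp [h0]
  have h3 : (3 : ℝ) ≤ M i j := by exact_mod_cast (by lia : 3 ≤ M i j)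
  have hcos : 0 < cos (π / M i j) := by
    refine cos_pos_of_mem_Ioo ⟨by linarith [pi_pos, show 0 < π / M i j by positivity], ?_⟩
    gcongr
    linarith
  simpa using hcos.ne'

/-- The reflection in the simple root `α i` of the standard geometric representation. -/
noncomputable def simpleRootReflection (i : B) : (B →₀ ℝ) ≃ₗ[ℝ] (B →₀ ℝ) :=
  reflection (simpleCoroot_single_self M i)

theorem simpleRootReflection_apply (i : B) (z : B →₀ ℝ) :
    simpleRootReflection M i z = z - simpleCoroot M i z • Finsupp.single i 1 :=
  reflection_apply ..

theorem isLiftable_simpleRootReflection : M.IsLiftable (simpleRootReflection M) := by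
  intro i j
  rcases eq_or_ne i j with rfl | hij
  · rw [M.diagonal, pow_one]
    exact LinearEquiv.ext (involutive_reflection (simpleCoroot_single_self M i))
  rcases Nat.lt_or_ge 2 (M i j) with hM | hM
  · refine reflection_mul_reflection_pow_eq_one _ _ hM ?_
    rw [simpleCoroot_single_comm M j i, simpleCoroot_single]
    ring
  obtain h0 | h2 : M i j = 0 ∨ M i j = 2 := by have := M.off_diagonal i j hij; lia
  · rw [h0, pow_zero]
  · have hi : simpleCoroot M i (Finsupp.single j 1) = 0 := by simp [simpleCoroot_single, h2]
    have hj : simpleCoroot M j (Finsupp.single i 1) = 0 := simpleCoroot_single_comm M i j ▸ hi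
    ext z : 1
    rw [h2]
    simp only [pow_two, LinearEquiv.mul_apply, simpleRootReflection_apply, map_sub, map_smul, hi,
      hj, simpleCoroot_single_self, LinearEquiv.coe_one, id]
    module

theorem not_commute_simple {M} {W : Type*} [Group W] (cs : CoxeterSystem M W) {i j : B}
    (hij : i ≠ j) (hM : M i j ≠ 2) : ¬Commute (cs.simple i) (cs.simple j) := by
  intro h
  have hcomm := (h.map (cs.lift ⟨_, isLiftable_simpleRootReflection M⟩)).eq
  rw [cs.lift_apply_simple, cs.lift_apply_simple] at hcomm
  have hcoeff := congrArg (fun σ : (B →₀ ℝ) ≃ₗ[ℝ] (B →₀ ℝ) ↦ σ (Finsupp.single i 1) j) hcomm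
  simp only [LinearEquiv.mul_apply, simpleRootReflection_apply, map_sub, map_smul,
    simpleCoroot_single_self, simpleCoroot_single_comm M j i, Finsupp.sub_apply,
    Finsupp.smul_apply, Finsupp.single_eq_same, Finsupp.single_eq_of_ne' hij, smul_eq_mul] at hcoeff
  exact simpleCoroot_single_ne_zero M hM (by linarith)

end GeometricRepresentation

section StrongExchange

variable {G : Type*} [Group G] {a b : G}

theorem mul_mul_pow_eq_inv_pow_mul (ha : a * a = 1) (hb : b * b = 1) (n : ℕ) :
    b * (a * b) ^ n = (a * b)⁻¹ ^ n * b := by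
  have h : SemiconjBy b (a * b) (a * b)⁻¹ := by
    rw [SemiconjBy, mul_inv_rev, inv_eq_of_mul_eq_one_left ha, inv_eq_of_mul_eq_one_left hb,
      mul_assoc]
  exact (h.pow_right n).eq

theorem mul_pow_conj_eq_right_iff (ha : a * a = 1) (hb : b * b = 1) (n : ℕ) (t : G) :
    (a * b) ^ n * t * ((a * b) ^ n)⁻¹ = b ↔ t = (a * b)⁻¹ ^ (2 * n) * b := by
  rw [mul_inv_eq_iff_eq_mul, mul_mul_pow_eq_inv_pow_mul ha hb, two_mul, pow_add,
    ← eq_inv_mul_iff_mul_eq, ← inv_pow, mul_assoc]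

theorem mul_pow_conj_eq_left_iff (ha : a * a = 1) (hb : b * b = 1) (n : ℕ) (t : G) :
    b * ((a * b) ^ n * t * ((a * b) ^ n)⁻¹) * b = a ↔ t = (a * b)⁻¹ ^ (2 * n + 1) * b := by
  have hb' : b⁻¹ = b := inv_eq_of_mul_eq_one_left hb
  calc b * ((a * b) ^ n * t * ((a * b) ^ n)⁻¹) * b = a
    _ ↔ (a * b) ^ n * t * ((a * b) ^ n)⁻¹ = (a * b)⁻¹ * b := by
      rw [mul_assoc b, ← eq_inv_mul_iff_mul_eq, ← eq_mul_inv_iff_mul_eq, mul_inv_rev,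
        inv_eq_of_mul_eq_one_left ha, hb']
    _ ↔ t = (a * b)⁻¹ ^ (2 * n + 1) * b := by
      rw [mul_inv_eq_iff_eq_mul, mul_assoc, mul_mul_pow_eq_inv_pow_mul ha hb,
        ← eq_inv_mul_iff_mul_eq, ← inv_pow, ← mul_assoc, ← mul_assoc, ← pow_succ, ← pow_add,
        Nat.add_right_comm, two_mul]

variable {B : Type*} {M : CoxeterMatrix B} {W : Type*} [Group W] (cs : CoxeterSystem M W)

local prefix:100 "s" => cs.simple
local prefix:100 "π" => cs.wordProd
local prefix:100 "ris" => cs.rightInvSeq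

open Classical in
/-- Bourbaki's action of the simple reflections on signed elements of `W`: conjugation on the
element, the sign being flipped exactly at the simple reflection itself. It serves to prove the
strong exchange property. -/
noncomputable def signedConj (i : B) : Equiv.Perm (W × ZMod 2) :=
  Function.Involutive.toPerm
    (fun p ↦ (s i * p.1 * s i, p.2 + if p.1 = s i then 1 else 0)) fun p ↦ by
      have h : s i * p.1 * s i = s i ↔ p.1 = s i := by
        rw [mul_eq_right, ← cs.inv_simple, inv_mul_eq_one, cs.inv_simple, eq_comm]
      simp only [h, add_assoc, CharTwo.add_self_eq_zero, add_zero]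
      simp [mul_assoc]

open Classical in
theorem signedConj_apply (i : B) (t : W) (e : ZMod 2) :
    signedConj cs i (t, e) = (s i * t * s i, e + if t = s i then 1 else 0) := rfl

open Classical in
theorem signedConj_mul_pow_apply (i j : B) (n : ℕ) (t : W) (e : ZMod 2) :
    ((signedConj cs i * signedConj cs j) ^ n) (t, e) =
      ((s i * s j) ^ n * t * ((s i * s j) ^ n)⁻¹,
        e + ∑ k ∈ Finset.range (2 * n), if t = (s i * s j)⁻¹ ^ k * s j then 1 else 0) := by
  induction n with
  | zero => simp
  | succ n ih =>
    have hi := cs.simple_mul_simple_self i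
    have hj := cs.simple_mul_simple_self j
    rw [pow_succ', Equiv.Perm.mul_apply, ih, Equiv.Perm.mul_apply,
      show 2 * (n + 1) = 2 * n + 1 + 1 by ring, Finset.sum_range_succ, Finset.sum_range_succ]
    simp only [signedConj_apply, mul_pow_conj_eq_right_iff hi hj, mul_pow_conj_eq_left_iff hi hj,
      add_assoc]
    simp [pow_succ', mul_assoc]

theorem isLiftable_signedConj : M.IsLiftable (signedConj cs) := by
  classical
  rintro i j
  have h : ∀ k, (s i * s j)⁻¹ ^ (M i j + k) = (s i * s j)⁻¹ ^ k := fun k ↦ by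
    rw [pow_add, inv_pow, cs.simple_mul_simple_pow, inv_one, one_mul]
  ext1 ⟨t, e⟩
  rw [signedConj_mul_pow_apply, cs.simple_mul_simple_pow, two_mul, Finset.sum_range_add]
  simp only [h, CharTwo.add_self_eq_zero, one_mul, inv_one, mul_one, add_zero,
    Equiv.Perm.coe_one, id]

/-- The parity of the number of occurrences of `t` in the right inversion sequence of any word
for `w`. -/
noncomputable def inversionParity (w t : W) : ZMod 2 :=
  (cs.lift ⟨signedConj cs, isLiftable_signedConj cs⟩ w (t, 0)).2

local notation "η" => inversionParity cs

theorem lift_signedConj_apply (w t : W) (e : ZMod 2) :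
    cs.lift ⟨signedConj cs, isLiftable_signedConj cs⟩ w (t, e) = (w * t * w⁻¹, e + η w t) := by
  induction w using cs.simple_induction_left generalizing t e with
  | one => simp [inversionParity]
  | mul_simple_left w i ih =>
    have key : ∀ e, cs.lift ⟨signedConj cs, isLiftable_signedConj cs⟩ (s i * w) (t, e) =
        signedConj cs i (w * t * w⁻¹, e + η w t) := fun e ↦ by
      rw [map_mul, cs.lift_apply_simple, Equiv.Perm.mul_apply, ih]
    rw [inversionParity, key, key]
    simp [signedConj_apply, mul_assoc, add_assoc]

theorem inversionParity_mul (u v t : W) : η (u * v) t = η v t + η u (v * t * v⁻¹) := by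
  have h := lift_signedConj_apply cs (u * v) t 0
  rw [map_mul, Equiv.Perm.mul_apply, lift_signedConj_apply, lift_signedConj_apply] at h
  simpa using (congrArg Prod.snd h).symm

open Classical in
theorem inversionParity_simple (i : B) (t : W) : η (s i) t = if t = s i then 1 else 0 := by
  simp [inversionParity, signedConj_apply]

theorem inversionParity_wordProd [DecidableEq W] (ω : List B) (t : W) :
    η (π ω) t = ((ris ω).count t : ℕ) := by
  induction ω with
  | nil => simp [inversionParity]
  | cons i ω ih =>
    have h : π ω * t * (π ω)⁻¹ = s i ↔ (π ω)⁻¹ * s i * π ω = t := by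
      rw [mul_inv_eq_iff_eq_mul, ← eq_inv_mul_iff_mul_eq, mul_assoc, eq_comm]
    rw [cs.wordProd_cons, inversionParity_mul, ih, inversionParity_simple,
      CoxeterSystem.rightInvSeq, List.count_cons]
    simp [h]

theorem inversionParity_self {t : W} (ht : cs.IsReflection t) : η t t = 1 := by
  obtain ⟨w, i, rfl⟩ := ht
  have hs : w⁻¹ * (w * s i * w⁻¹) * w⁻¹⁻¹ = s i := by group
  have h0 : η w⁻¹ (w * s i * w⁻¹) + η w (s i) = 0 := by
    nth_rw 2 [← hs]
    rw [← inversionParity_mul, mul_inv_cancel]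
    simp [inversionParity]
  rw [inversionParity_mul, hs, inversionParity_mul, mul_inv_cancel_right, inversionParity_simple,
    if_pos rfl, add_left_comm, h0, add_zero]

theorem isRightInversion_of_inversionParity {w t : W} (h : η w t = 1) :
    cs.IsRightInversion w t := by
  classical
  obtain ⟨ω, hω, rfl⟩ := cs.exists_isReduced w
  refine cs.isRightInversion_of_mem_rightInvSeq hω (List.count_pos_iff.1 ?_)
  rw [inversionParity_wordProd] at h
  refine Nat.pos_of_ne_zero fun h0 ↦ ?_
  simp [h0] at h

theorem inversionParity_eq_one_iff {w t : W} : η w t = 1 ↔ cs.IsRightInversion w t := by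
  refine ⟨isRightInversion_of_inversionParity cs, fun h ↦ ?_⟩
  by_contra h0
  refine (h.1.isRightInversion_mul_left_iff (w := w)).1 ?_ h
  refine isRightInversion_of_inversionParity cs ?_
  rw [inversionParity_mul, inversionParity_self cs h.1, mul_inv_cancel_right]
  revert h0
  generalize η w t = x
  revert x
  decide

theorem isRightInversion_mul_iff (u v t : W) :
    cs.IsRightInversion (u * v) t ↔
      Xor (cs.IsRightInversion v t) (cs.IsRightInversion u (v * t * v⁻¹)) := by
  simp only [← inversionParity_eq_one_iff, inversionParity_mul]
  generalize η v t = x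
  generalize η u _ = y
  revert x y
  decide

theorem isRightInversion_simple_iff {i : B} {t : W} :
    cs.IsRightInversion (s i) t ↔ t = s i := by
  classical
  rw [← inversionParity_eq_one_iff, inversionParity_simple]
  simp

theorem isLeftInversion_mul_iff (u v t : W) :
    cs.IsLeftInversion (u * v) t ↔
      Xor (cs.IsLeftInversion u t) (cs.IsLeftInversion v (u⁻¹ * t * u)) := by
  simp only [← cs.isRightInversion_inv_iff, mul_inv_rev]
  rw [isRightInversion_mul_iff, inv_inv]

theorem isLeftInversion_simple_iff {i : B} {t : W} :
    cs.IsLeftInversion (s i) t ↔ t = s i := by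
  rw [← cs.isRightInversion_inv_iff, cs.inv_simple, isRightInversion_simple_iff]

end StrongExchange

section Descents

variable {B : Type*} {M : CoxeterMatrix B} {W : Type*} [Group W] (cs : CoxeterSystem M W)
  {w : W} {i j k : B}

local prefix:100 "s" => cs.simple
local prefix:100 "ℓ" => cs.length

theorem isRightDescent_mul_simple_self_iff :
    cs.IsRightDescent (w * s i) i ↔ ¬cs.IsRightDescent w i :=
  (not_iff_comm.1 cs.isRightDescent_iff_not_isRightDescent_mul.symm).symm

theorem isRightInversion_mul_simple_conj {t : W} (ht : cs.IsRightInversion w t) (hti : t ≠ s i) :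
    cs.IsRightInversion (w * s i) (s i * t * s i) := by
  rw [← cs.simple_mul_simple_cancel_right (w := w) i, isRightInversion_mul_iff,
    isRightInversion_simple_iff, cs.inv_simple] at ht
  simpa [hti] using ht

theorem isRightDescent_mul_simple (hij : i ≠ j) (hM : M i j ≠ 2) (hi : cs.IsRightDescent w i)
    (hj : cs.IsRightDescent w j) : cs.IsRightDescent (w * s i) j := by
  have hne : s i ≠ s j := fun h ↦ not_commute_simple cs hij hM (h ▸ Commute.refl _)
  have h := isRightInversion_mul_simple_conj cs
    ((cs.isRightInversion_simple_iff_isRightDescent w i).2 hi) hne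
  have hlt : ℓ (w * s i * s j) < ℓ (w * s j) := by simpa [mul_assoc] using h.2
  rw [cs.isRightDescent_iff] at hi hj
  exact lt_of_lt_of_eq hlt (by lia)

theorem isRightDescent_mul_simple_mul_simple (hij : i ≠ j) (hM : M i j ≠ 2)
    (hi : cs.IsRightDescent w i) (hj : cs.IsRightDescent w j) :
    cs.IsRightDescent (w * s i * s j) i := by
  have hcomm := not_commute_simple cs hij hM
  have hne : s j ≠ s i := fun h ↦ hcomm (h ▸ Commute.refl _)
  have hne' : s j * s i * s j ≠ s i := fun h ↦ hcomm <| by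
    rw [commute_iff_eq]
    nth_rw 1 [← h]
    simp
  have hij' := isRightDescent_mul_simple cs hij hM hi hj
  have hji' := isRightDescent_mul_simple cs hij.symm (M.symmetric i j ▸ hM) hj hi
  have h := isRightInversion_mul_simple_conj cs (isRightInversion_mul_simple_conj cs
    ((cs.isRightInversion_simple_iff_isRightDescent w i).2 hi) hne.symm) hne'
  have hlt : ℓ (w * s i * s j * s i) < ℓ (w * s j * s i) := by simpa [mul_assoc] using h.2
  rw [cs.isRightDescent_iff] at hi hj hij' hji'
  exact lt_of_lt_of_eq hlt (by lia)

theorem length_mul_simple_mul_simple (hij : i ≠ j) (hM : M i j ≠ 2)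
    (hi : ¬cs.IsRightDescent w i) (hj : ¬cs.IsRightDescent w j) :
    ℓ (w * s i * s j) = ℓ w + 2 := by
  have h : ¬cs.IsRightDescent (w * s i) j := fun h ↦ hj <| by
    simpa using
      isRightDescent_mul_simple cs hij hM ((isRightDescent_mul_simple_self_iff cs).2 hi) h
  rw [cs.not_isRightDescent_iff.1 h, cs.not_isRightDescent_iff.1 hi]

variable (hM : ∀ i j, M i j ≠ 2)

include hM in
theorem eq_of_isRightDescent_mul_simple (hij : i ≠ j) (hi : cs.IsRightDescent w i)
    (hj : cs.IsRightDescent w j) (hk : cs.IsRightDescent (w * s i) k) : k = j := by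
  induction hn : ℓ w using Nat.strong_induction_on generalizing w i j k with
  | _ n ih =>
    by_contra hkj
    have hj' := isRightDescent_mul_simple cs hij (hM i j) hi hj
    have hi' := isRightDescent_mul_simple_mul_simple cs hij (hM i j) hi hj
    obtain rfl : i = k := ih _ (hn ▸ hi) (Ne.symm hkj) hj' hk hi' rfl
    exact cs.isRightDescent_iff_not_isRightDescent_mul.1 hi hk

include hM in
theorem not_isRightDescent_of_isRightDescent_of_ne (hij : i ≠ j) (hik : i ≠ k) (hjk : j ≠ k)
    (hi : cs.IsRightDescent w i) (hj : cs.IsRightDescent w j) : ¬cs.IsRightDescent w k := fun hk ↦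
  hjk (eq_of_isRightDescent_mul_simple cs hM hij hi hj
    (isRightDescent_mul_simple cs hik (hM i k) hi hk)).symm

include hM in
theorem exists_ne_not_isRightDescent (hB : 3 < Cardinal.mk B) (w : W) (i : B) :
    ∃ j ≠ i, ¬cs.IsRightDescent w j := by
  by_contra! h
  obtain ⟨x, hx⟩ := Cardinal.exists_notMem_of_length_lt [i] (lt_of_le_of_lt (by norm_num) hB)
  obtain ⟨y, hy⟩ := Cardinal.exists_notMem_of_length_lt [i, x] (lt_of_le_of_lt (by norm_num) hB)
  obtain ⟨z, hz⟩ := Cardinal.exists_notMem_of_length_lt [i, x, y] (by simpa using hB)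
  simp only [List.mem_cons, List.not_mem_nil, or_false, not_or] at hx hy hz
  exact not_isRightDescent_of_isRightDescent_of_ne cs hM hz.2.1 hz.2.2 (Ne.symm hy.2)
    (h z hz.1) (h x hx) (h y hy.1)

end Descents

section FundamentalChambers

variable {B : Type*} {M : CoxeterMatrix B} {W : Type*} [Group W] (cs : CoxeterSystem M W)

local prefix:100 "s" => cs.simple

/-- The elements of `W`, viewed as chambers, that no reflection of `V` separates from the identity.
When `V` is generated by reflections, they form a fundamental domain for it. -/
def fundamentalChambers (V : Subgroup W) : Set W :=
  {p | ∀ t ∈ V, ¬cs.IsLeftInversion p t}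

/-- Dyer's canonical generators of the reflection subgroup generated by the reflections in `V`:
the reflections of `V` whose only inversion in `V` is themselves. -/
def canonicalReflections (V : Subgroup W) : Set W :=
  {r | r ∈ V ∧ cs.IsReflection r ∧ ∀ t ∈ V, cs.IsRightInversion r t → t = r}

variable {cs} {V : Subgroup W} {p : W} {i j : B}

theorem one_mem_fundamentalChambers : 1 ∈ fundamentalChambers cs V := fun t _ h ↦ by
  simpa using h.2

theorem isLeftInversion_mul_simple_iff (hp : p ∈ fundamentalChambers cs V) {t : W} (ht : t ∈ V) :
    cs.IsLeftInversion (p * s i) t ↔ t = p * s i * p⁻¹ := by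
  rw [isLeftInversion_mul_iff, isLeftInversion_simple_iff, eq_mul_inv_iff_mul_eq,
    ← inv_mul_eq_iff_eq_mul, ← mul_assoc]
  simp [hp t ht]

theorem mul_simple_mem_fundamentalChambers_iff (hp : p ∈ fundamentalChambers cs V) :
    p * s i ∈ fundamentalChambers cs V ↔ p * s i * p⁻¹ ∉ V := by
  constructor
  · exact fun h ht ↦ h _ ht ((isLeftInversion_mul_simple_iff hp ht).2 rfl)
  · rintro h t ht hinv
    exact h ((isLeftInversion_mul_simple_iff hp ht).1 hinv ▸ ht)

theorem mul_simple_mem_fundamentalChambers (hp : p ∈ fundamentalChambers cs V)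
    (h : cs.IsRightDescent p i) : p * s i ∈ fundamentalChambers cs V := by
  rw [mul_simple_mem_fundamentalChambers_iff hp]
  refine fun ht ↦ hp _ ht ⟨⟨p, i, rfl⟩, ?_⟩
  simpa [CoxeterSystem.IsRightDescent] using h

theorem not_isRightInversion_of_mem_fundamentalChambers (hp : p ∈ fundamentalChambers cs V) {t : W}
    (ht : p * t * p⁻¹ ∈ V) : ¬cs.IsRightInversion p t := fun h ↦
  hp _ ht ⟨h.1.conj p, by simpa using h.2⟩

theorem conj_simple_mem_canonicalReflections (hp : p ∈ fundamentalChambers cs V)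
    (hr : p * s i * p⁻¹ ∈ V) : p * s i * p⁻¹ ∈ canonicalReflections cs V := by
  refine ⟨hr, ⟨p, i, rfl⟩, fun t ht h ↦ ?_⟩
  have hmem : p * (s i * (p⁻¹ * t * p) * s i) * p⁻¹ ∈ V := by
    convert V.mul_mem (V.mul_mem hr ht) (V.inv_mem hr) using 1
    simp [mul_assoc]
  simp only [isRightInversion_mul_iff, cs.isRightInversion_inv_iff, inv_inv, cs.inv_simple,
    isRightInversion_simple_iff] at h
  have hts : p⁻¹ * t * p = s i := by
    simpa [Xor, hp t ht, not_isRightInversion_of_mem_fundamentalChambers hp hmem] using h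
  rw [← hts]
  group

theorem exists_mul_fundamentalChamber_eq (w : W) :
    ∃ v ∈ Subgroup.closure (canonicalReflections cs V),
      ∃ p ∈ fundamentalChambers cs V, v * p = w := by
  induction w using cs.simple_induction_right with
  | one => exact ⟨1, one_mem _, 1, one_mem_fundamentalChambers, one_mul 1⟩
  | mul_simple_right w i ih =>
    obtain ⟨v, hv, p, hp, rfl⟩ := ih
    by_cases hr : p * s i * p⁻¹ ∈ V
    · refine ⟨v * (p * s i * p⁻¹), mul_mem hv (Subgroup.subset_closure ?_), p, hp, by group⟩
      exact conj_simple_mem_canonicalReflections hp hr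
    · exact ⟨v, hv, p * s i, (mul_simple_mem_fundamentalChambers_iff hp).2 hr, by group⟩

theorem closure_canonicalReflections
    (hV : ∃ T : Set W, (∀ t ∈ T, cs.IsReflection t) ∧ V = Subgroup.closure T) :
    Subgroup.closure (canonicalReflections cs V) = V := by
  obtain ⟨T, hT, hVT⟩ := hV
  have hle : Subgroup.closure (canonicalReflections cs V) ≤ V :=
    (Subgroup.closure_le V).2 fun r hr ↦ hr.1
  refine hle.antisymm ?_
  conv_lhs => rw [hVT]
  refine (Subgroup.closure_le _).2 fun t ht ↦ SetLike.mem_coe.2 ?_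
  have htV : t ∈ V := hVT ▸ Subgroup.subset_closure ht
  obtain ⟨w, i, rfl⟩ := hT t ht
  obtain ⟨v, hv, p, hp, rfl⟩ := exists_mul_fundamentalChamber_eq (cs := cs) (V := V) w
  have hr : p * s i * p⁻¹ ∈ V := by
    convert V.mul_mem (V.mul_mem (V.inv_mem (hle hv)) htV) (hle hv) using 1
    group
  convert mul_mem (mul_mem hv (Subgroup.subset_closure
    (conj_simple_mem_canonicalReflections hp hr))) (inv_mem hv) using 1
  group

theorem exists_shorter_list_of_isRightInversion {l : List W}
    (hl : ∀ r ∈ l, r ∈ canonicalReflections cs V) {t : W} (ht : t ∈ V)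
    (h : cs.IsRightInversion l.prod t) :
    ∃ l' : List W, (∀ r ∈ l', r ∈ canonicalReflections cs V) ∧ l'.length < l.length ∧
      l'.prod = l.prod * t := by
  induction l with
  | nil => simp [CoxeterSystem.IsRightInversion] at h
  | cons r l ih =>
    obtain ⟨hr, hl⟩ := List.forall_mem_cons.1 hl
    rw [List.prod_cons, isRightInversion_mul_iff] at h
    obtain ⟨h, -⟩ | ⟨h, -⟩ := h
    · obtain ⟨l', hl', hlen, hprod⟩ := ih hl h
      exact ⟨r :: l', List.forall_mem_cons.2 ⟨hr, hl'⟩, by simpa using hlen,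
        by simp [hprod, mul_assoc]⟩
    · have hlV : l.prod ∈ V := list_prod_mem fun x hx ↦ (hl x hx).1
      have hrt : l.prod * t * l.prod⁻¹ = r :=
        hr.2.2 _ (V.mul_mem (V.mul_mem hlV ht) (V.inv_mem hlV)) h
      refine ⟨l, hl, by simp, ?_⟩
      rw [List.prod_cons, mul_assoc, mul_inv_eq_iff_eq_mul.1 hrt, ← mul_assoc,
        hr.2.1.mul_self, one_mul]

theorem prod_eq_one_of_forall_not_isRightInversion {l : List W}
    (hl : ∀ r ∈ l, r ∈ canonicalReflections cs V)
    (h : ∀ t ∈ V, ¬cs.IsRightInversion l.prod t) : l.prod = 1 := by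
  induction hn : l.length using Nat.strong_induction_on generalizing l with
  | _ n ih =>
    obtain rfl | ⟨l, r, rfl⟩ := List.eq_nil_or_concat' l
    · rfl
    obtain ⟨hl₀, hr⟩ : (∀ x ∈ l, x ∈ canonicalReflections cs V) ∧
        r ∈ canonicalReflections cs V := by simpa [or_imp, forall_and] using hl
    have hprod : (l ++ [r]).prod = l.prod * r := by simp
    have hinv : cs.IsRightInversion l.prod r := by
      rw [← not_not (a := cs.IsRightInversion _ _), ← hr.2.1.isRightInversion_mul_left_iff, ← hprod]
      exact h r hr.1
    obtain ⟨l', hl', hlen, hprod'⟩ := exists_shorter_list_of_isRightInversion hl₀ hr.1 hinv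
    rw [hprod, ← hprod'] at h ⊢
    exact ih _ (by rw [List.length_append, List.length_singleton] at hn; lia) hl' h rfl

theorem eq_one_of_forall_not_isRightInversion
    (hV : ∃ T : Set W, (∀ t ∈ T, cs.IsReflection t) ∧ V = Subgroup.closure T) {v : W} (hv : v ∈ V)
    (h : ∀ t ∈ V, ¬cs.IsRightInversion v t) : v = 1 := by
  rw [← closure_canonicalReflections hV, ← Subgroup.mem_toSubmonoid,
    Subgroup.closure_toSubmonoid] at hv
  obtain ⟨l, hl, rfl⟩ := Submonoid.exists_list_of_mem_closure hv
  refine prod_eq_one_of_forall_not_isRightInversion (fun r hr ↦ (hl r hr).elim id fun hr' ↦ ?_) h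
  rw [Set.mem_inv] at hr'
  rwa [← inv_inv r, hr'.2.1.inv]

theorem eq_of_mem_fundamentalChambers_of_mul_inv_mem
    (hV : ∃ T : Set W, (∀ t ∈ T, cs.IsReflection t) ∧ V = Subgroup.closure T) {q : W}
    (hp : p ∈ fundamentalChambers cs V) (hq : q ∈ fundamentalChambers cs V)
    (hpq : p * q⁻¹ ∈ V) : p = q := by
  refine mul_inv_eq_one.1 (eq_one_of_forall_not_isRightInversion hV hpq fun t ht h ↦ ?_)
  have hmem : p * (q⁻¹ * t * q) * p⁻¹ ∈ V := by
    convert V.mul_mem (V.mul_mem hpq ht) (V.inv_mem hpq) using 1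
    group
  rw [isRightInversion_mul_iff, cs.isRightInversion_inv_iff, inv_inv] at h
  simp [hq t ht, not_isRightInversion_of_mem_fundamentalChambers hp hmem] at h

theorem finite_fundamentalChambers
    (hV : ∃ T : Set W, (∀ t ∈ T, cs.IsReflection t) ∧ V = Subgroup.closure T) [V.FiniteIndex] :
    (fundamentalChambers cs V).Finite := by
  refine Set.Finite.of_injOn (f := fun p ↦ (QuotientGroup.mk p⁻¹ : W ⧸ V)) (t := Set.univ)
    (fun _ _ ↦ trivial) (fun p hp q hq hpq ↦ ?_) Set.finite_univ
  refine eq_of_mem_fundamentalChambers_of_mul_inv_mem hV hp hq ?_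
  simpa using QuotientGroup.eq.1 hpq

/- The fundamental chambers in the residue `p ⟨s i, s j⟩` form a sector, and the reflections in its
two bounding walls generate a subgroup of the finite dihedral group: the size of the sector divides
`M i j`. Hence a sector starting at the wall between `p` and `p * s j` does not end after `n + 1`
chambers when `n + 1` is coprime to `M i j`, unless it ends after one. -/
theorem conj_pow_mul_simple_notMem {n : ℕ} (hn : (n + 1).Coprime (M i j))
    (hj : p * s j * p⁻¹ ∈ V) (hi : p * s i * p⁻¹ ∉ V) :
    p * ((s i * s j) ^ n * s i) * p⁻¹ ∉ V := by
  refine fun h ↦ hi ?_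
  have hpow : (p * (s i * s j) * p⁻¹) ^ (n + 1) ∈ V := by
    convert V.mul_mem h hj using 1
    rw [conj_pow, pow_succ]
    group
  have hm : (p * (s i * s j) * p⁻¹) ^ M i j = 1 := by
    rw [conj_pow, cs.simple_mul_simple_pow, mul_one, mul_inv_cancel]
  obtain ⟨k, hk⟩ :=
    exists_pow_eq_self_of_coprime (hn.coprime_dvd_right (orderOf_dvd_of_pow_eq_one hm))
  convert V.mul_mem (hk ▸ V.pow_mem hpow k) hj using 1
  simp [mul_assoc]

theorem mul_simple_mul_simple_mem (hodd : Odd (M i j)) (hp : p ∈ fundamentalChambers cs V)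
    (hj : p * s j ∉ fundamentalChambers cs V) (hi : p * s i ∈ fundamentalChambers cs V) :
    p * s i * s j ∈ fundamentalChambers cs V := by
  rw [mul_simple_mem_fundamentalChambers_iff hp] at hj
  rw [mul_simple_mem_fundamentalChambers_iff hi]
  convert conj_pow_mul_simple_notMem (n := 1) hodd.coprime_two_left (not_not.1 hj)
    ((mul_simple_mem_fundamentalChambers_iff hp).1 hi) using 2
  simp [mul_assoc]

theorem mul_simple_mul_simple_mul_simple_mem (hodd : Odd (M i j)) (h3 : ¬3 ∣ M i j)
    (hp : p ∈ fundamentalChambers cs V) (hj : p * s j ∉ fundamentalChambers cs V)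
    (hi : p * s i ∈ fundamentalChambers cs V) :
    p * s i * s j * s i ∈ fundamentalChambers cs V := by
  have hij := mul_simple_mul_simple_mem hodd hp hj hi
  rw [mul_simple_mem_fundamentalChambers_iff hp] at hj
  rw [mul_simple_mem_fundamentalChambers_iff hij]
  convert conj_pow_mul_simple_notMem (n := 2) (Nat.prime_three.coprime_iff_not_dvd.2 h3)
    (not_not.1 hj) ((mul_simple_mem_fundamentalChambers_iff hp).1 hi) using 2
  simp [pow_succ, mul_assoc]

theorem mul_simple_mul_simple_mul_simple_mul_simple_mem (hodd : Odd (M i j)) (h3 : ¬3 ∣ M i j)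
    (hp : p ∈ fundamentalChambers cs V) (hj : p * s j ∉ fundamentalChambers cs V)
    (hi : p * s i ∈ fundamentalChambers cs V) :
    p * s i * s j * s i * s j ∈ fundamentalChambers cs V := by
  have hiji := mul_simple_mul_simple_mul_simple_mem hodd h3 hp hj hi
  rw [mul_simple_mem_fundamentalChambers_iff hp] at hj
  rw [mul_simple_mem_fundamentalChambers_iff hiji]
  convert conj_pow_mul_simple_notMem (n := 3) (hodd.coprime_two_left.pow_left 2)
    (not_not.1 hj) ((mul_simple_mem_fundamentalChambers_iff hp).1 hi) using 2
  simp [pow_succ, mul_assoc]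

end FundamentalChambers

section FarthestChambers

variable {B : Type*} {M : CoxeterMatrix B} {W : Type*} [Group W] {cs : CoxeterSystem M W}
  {V : Subgroup W} {c : W} {i j o : B}

local prefix:100 "s" => cs.simple
local prefix:100 "ℓ" => cs.length

variable (cs V c) in
/-- A fundamental chamber of `V` at maximal distance from the identity chamber. -/
def IsFarthestChamber : Prop :=
  c ∈ fundamentalChambers cs V ∧ ∀ p ∈ fundamentalChambers cs V, ℓ p ≤ ℓ c

namespace IsFarthestChamber

theorem mul_simple_notMem (hc : IsFarthestChamber cs V c) (hi : ¬cs.IsRightDescent c i) :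
    c * s i ∉ fundamentalChambers cs V := fun h ↦ by
  have := hc.2 _ h
  have := cs.not_isRightDescent_iff.1 hi
  lia

theorem mul_simple_mul_simple (hc : IsFarthestChamber cs V c) (hodd : Odd (M i j))
    (hi : cs.IsRightDescent c i) (hj : ¬cs.IsRightDescent c j)
    (hij : ¬cs.IsRightDescent (c * s i) j) : IsFarthestChamber cs V (c * s i * s j) := by
  refine ⟨mul_simple_mul_simple_mem hodd hc.1 (hc.mul_simple_notMem hj)
    (mul_simple_mem_fundamentalChambers hc.1 hi), ?_⟩
  rw [cs.not_isRightDescent_iff.1 hij, cs.isRightDescent_iff.1 hi]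
  exact hc.2

theorem isRightDescent_mul_simple_of_not (hc : IsFarthestChamber cs V c) (hodd : Odd (M i j))
    (h3 : ¬3 ∣ M i j) (hi : cs.IsRightDescent c i) (hj : ¬cs.IsRightDescent c j) :
    cs.IsRightDescent (c * s i) j := by
  by_contra hij
  have hii : ¬cs.IsRightDescent (c * s i) i := cs.isRightDescent_iff_not_isRightDescent_mul.1 hi
  have hne : j ≠ i := fun h ↦ hj (h ▸ hi)
  have hM : M j i ≠ 2 := M.symmetric i j ▸ hodd.ne_two_of_dvd_nat dvd_rfl
  have hlen := length_mul_simple_mul_simple cs hne hM hij hii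
  have hle := hc.2 _ (mul_simple_mul_simple_mul_simple_mem hodd h3 hc.1 (hc.mul_simple_notMem hj)
    (mul_simple_mem_fundamentalChambers hc.1 hi))
  have := cs.isRightDescent_iff.1 hi
  lia

variable (hodd : ∀ i j, Odd (M i j)) (h3 : ∀ i, ¬3 ∣ M o i) (hB : 3 < Cardinal.mk B)

include hodd h3 hB

theorem exists_ne_root_isRightDescent (hc : IsFarthestChamber cs V c)
    (ho : cs.IsRightDescent c o) : ∃ j ≠ o, cs.IsRightDescent c j := by
  by_contra! h
  obtain ⟨j, hjo, hj⟩ := exists_ne_not_isRightDescent cs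
    (fun i j ↦ (hodd i j).ne_two_of_dvd_nat dvd_rfl) hB (c * s o) o
  exact hj (hc.isRightDescent_mul_simple_of_not (hodd o j) (h3 j) ho (h j hjo))

theorem isRightDescent_mul_simple_mul_root (hc : IsFarthestChamber cs V c)
    (hi : cs.IsRightDescent c i) (ho : cs.IsRightDescent (c * s i) o) :
    cs.IsRightDescent (c * s i * s o) i := by
  have hM (i j : B) : M i j ≠ 2 := (hodd i j).ne_two_of_dvd_nat dvd_rfl
  have hio : i ≠ o := by
    rintro rfl
    exact cs.isRightDescent_iff_not_isRightDescent_mul.1 hi ho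
  by_cases hco : cs.IsRightDescent c o
  · exact isRightDescent_mul_simple_mul_simple cs hio (hM i o) hi hco
  by_contra hi'
  have ho' : ¬cs.IsRightDescent (c * s i * s o) o :=
    cs.isRightDescent_iff_not_isRightDescent_mul.1 ho
  have hlen := length_mul_simple_mul_simple cs hio (hM i o) hi' ho'
  have hfar : IsFarthestChamber cs V (c * s i * s o * s i * s o) := by
    refine ⟨mul_simple_mul_simple_mul_simple_mul_simple_mem (hodd i o) (M.symmetric i o ▸ h3 i)
      hc.1 (hc.mul_simple_notMem hco) (mul_simple_mem_fundamentalChambers hc.1 hi), ?_⟩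
    rw [hlen]
    rw [cs.isRightDescent_iff] at hi ho
    exact fun p hp ↦ (hc.2 p hp).trans (by lia)
  have hoi : ¬cs.IsRightDescent (c * s i * s o * s i) o := by
    rw [cs.not_isRightDescent_iff] at hi' ⊢
    lia
  have hfo := (isRightDescent_mul_simple_self_iff cs).2 hoi
  have hfi : cs.IsRightDescent (c * s i * s o * s i * s o * s o) i := by
    rwa [cs.simple_mul_simple_cancel_right, isRightDescent_mul_simple_self_iff]
  obtain ⟨x, hxo, hx⟩ := hfar.exists_ne_root_isRightDescent hodd h3 hB hfo
  obtain rfl := eq_of_isRightDescent_mul_simple cs hM hxo.symm hfo hx hfi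
  have := isRightDescent_mul_simple_mul_simple cs hxo.symm (hM o i) hfo hx
  simp only [cs.simple_mul_simple_cancel_right] at this
  exact ho' this

theorem exists_ne_isRightDescent (hc : IsFarthestChamber cs V c) (hi : cs.IsRightDescent c i) :
    ∃ j ≠ i, cs.IsRightDescent c j := by
  obtain rfl | hio := eq_or_ne i o
  · exact hc.exists_ne_root_isRightDescent hodd h3 hB hi
  by_contra! h
  have hM (i j : B) : M i j ≠ 2 := (hodd i j).ne_two_of_dvd_nat dvd_rfl
  have ho : cs.IsRightDescent (c * s i) o :=
    hc.isRightDescent_mul_simple_of_not (hodd i o) (M.symmetric i o ▸ h3 i) hi (h o hio.symm)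
  obtain ⟨j, hjo, hj'⟩ := exists_ne_not_isRightDescent cs hM hB (c * s i * s o) o
  obtain rfl | hji := eq_or_ne j i
  · exact hj' (hc.isRightDescent_mul_simple_mul_root hodd h3 hB hi ho)
  by_cases hj : cs.IsRightDescent (c * s i) j
  · exact hj' (isRightDescent_mul_simple cs hjo.symm (hM o j) ho hj)
  have hfar := hc.mul_simple_mul_simple (hodd i j) hi (h j hji) hj
  refine hj' ?_
  simpa using hfar.isRightDescent_mul_simple_mul_root hodd h3 hB
    ((isRightDescent_mul_simple_self_iff cs).2 hj) (by simpa using ho)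

theorem not_isRightDescent (hc : IsFarthestChamber cs V c) : ¬cs.IsRightDescent c i := by
  intro hi
  obtain ⟨j, hji, hj⟩ := hc.exists_ne_isRightDescent hodd h3 hB hi
  have hM (i j : B) : M i j ≠ 2 := (hodd i j).ne_two_of_dvd_nat dvd_rfl
  have hij := isRightDescent_mul_simple cs hji.symm (hM i j) hi hj
  obtain ⟨l, hlj, hl'⟩ := exists_ne_not_isRightDescent cs hM hB (c * s i * s j) j
  obtain rfl | hli := eq_or_ne l i
  · exact hl' (isRightDescent_mul_simple_mul_simple cs hji.symm (hM l j) hi hj)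
  have hl : ¬cs.IsRightDescent c l :=
    not_isRightDescent_of_isRightDescent_of_ne cs hM hji.symm hli.symm hlj.symm hi hj
  have hil : ¬cs.IsRightDescent (c * s i) l := fun h ↦
    hlj (eq_of_isRightDescent_mul_simple cs hM hji.symm hi hj h)
  have hfar := hc.mul_simple_mul_simple (hodd i l) hi hl hil
  have hfl := (isRightDescent_mul_simple_self_iff cs).2 hil
  obtain ⟨x, hxl, hx⟩ := hfar.exists_ne_isRightDescent hodd h3 hB hfl
  obtain rfl := eq_of_isRightDescent_mul_simple cs hM hxl.symm hfl hx (by simpa using hij)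
  refine hl' ?_
  simpa using isRightDescent_mul_simple_mul_simple cs hlj (hM l j) hfl hx

end IsFarthestChamber

end FarthestChambers

theorem lemma5p12_general {B W : Type*} [Group W] {M : CoxeterMatrix B} (cs : CoxeterSystem M W)
    (hB : 3 < Cardinal.mk B) (o : B) (hodd : ∀ i j, Odd (M i j)) (h3 : ∀ i, ¬3 ∣ M o i) :
    ¬∃ V : Subgroup W, cs.IsReflectionSubgroup V ∧ V.FiniteIndex := by
  rintro ⟨V, ⟨hne, hV⟩, _⟩
  obtain ⟨c, hc⟩ : ∃ c, IsFarthestChamber cs V c :=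
    Set.exists_max_image _ cs.length (finite_fundamentalChambers hV)
      ⟨1, one_mem_fundamentalChambers⟩
  have hdesc (i : B) : ¬cs.IsRightDescent c i := hc.not_isRightDescent hodd h3 hB
  obtain rfl : c = 1 := not_not.1 fun h ↦ (cs.exists_rightDescent_of_ne_one h).elim hdesc
  refine hne (top_le_iff.1 ?_)
  rw [← cs.subgroup_closure_range_simple, Subgroup.closure_le]
  rintro _ ⟨i, rfl⟩
  have hi := hc.mul_simple_notMem (hdesc i)
  rw [mul_simple_mem_fundamentalChambers_iff hc.1] at hi
  simpa using hi

theorem lemma5p12 {W : Type*} [Group W] (M : CoxeterMatrix (Fin 4)) (cs : CoxeterSystem M W)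
    (hodd : M.IsOddAngled)
    (k : Fin 4 → ℕ) (k' : Fin 4 → Fin 4 → ℕ)
    (hk : ∀ i : Fin 4, i ≠ 0 → 0 < k i ∧ ¬ 3 ∣ k i ∧ M 0 i = 5 * k i)
    (hk' : ∀ i j : Fin 4, i ≠ 0 → j ≠ 0 → i ≠ j → 0 < k' i j ∧ M i j = 3 * k' i j) :
    ¬ ∃ V : Subgroup W, cs.IsReflectionSubgroup V ∧ V.FiniteIndex := by
  have h0 (i j : Fin 4) : M i j ≠ 0 := by
    rcases eq_or_ne i j with rfl | hij
    · simp
    rcases eq_or_ne i 0 with rfl | hi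
    · grind
    rcases eq_or_ne j 0 with rfl | hj
    · grind [M.symmetric i 0]
    · grind
  have h3 (i : Fin 4) : ¬3 ∣ M 0 i := by
    rcases eq_or_ne i 0 with rfl | hi
    · simp
    · obtain ⟨-, h3k, hM⟩ := hk i hi
      lia
  exact lemma5p12_general cs (by rw [Cardinal.mk_fin]; norm_num) 0
    (fun i j ↦ (hodd i j).resolve_left (h0 i j)) h3
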